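/- Let $E$ be a topological space. The *tandem Banach–Mazur game* on $E$ is played by two players $\beta'$ and $\alpha'$ on two boards. Player $\beta'$ chooses a non-empty open set $V_1$, and $\alpha'$ answers with a non-empty open $V_1'\subset V_1$; then $\beta'$ chooses a non-empty open set $W_1$, and $\alpha'$ answers with a non-empty open $W_1'\subset W_1$. In general, for $k\ge 1$, $\beta'$ chooses a non-empty open $V_{k+1}\subset V_k'$, $\alpha'$ a non-empty open $V_{k+1}'\subset V_{k+1}$, $\beta'$ a non-empty open $W_{k+1}\subset W_k'$, and $\alpha'$ a non-empty open $W_{k+1}'\subset W_{k+1}$. Player $\alpha'$ wins the play if both $\bigcap_{k}V_k\neq\emptyset$ and $\bigcap_k W_k\neq\emptyset$; otherwise $\beta'$ wins. A strategy of a player is a map that assigns, to every finite sequence of non-empty open sets of the appropriate length (all previous moves on both boards), a next move of that player satisfying the inclusion above; a strategy is winning if it beats every strategy of the opponent. The space $E$ is called *$\tau$-Baire* if for every strategy of $\beta'$ there is a strategy of $\alpha'$ which beats it. The game on $E$ is *determined* if $\alpha'$ or $\beta'$ has a winning strategy. **Proposition.** Let $G$ be a metrizable topological group. 1. If $G$ is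 $\tau$-Baire, then $G$ is completely metrizable, and $G$ coincides with its two-sided completion, i.e. the canonical map from $G$ to its completion with respect to the two-sided uniformity (the coarsest uniformity finer than both the left and the right uniformity) is an isomorphism of uniform spaces. 2. The tandem Banach–Mazur game on $G$ is determined. -/

import Mathlib

open TopologicalSpace

/-! ### The tandem Banach-Mazur game

The moves of a play are numbered `0, 1, 2, 3, 4, …` in the order of time, so a play is the sequence
`V₁, V₁', W₁, W₁', V₂, V₂', W₂, W₂', …`.  Player `β'` makes the moves with an even number,
player `α'` those with an odd number.  Thus `V` with (zero-based) index `k` is the move `4 * k`,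
`V'` is `4 * k + 1`, `W` is `4 * k + 2` and `W'` is `4 * k + 3`. -/

namespace TandemGame

/-- A move: a non-empty open subset of `E`. -/
abbrev Move (E : Type*) [TopologicalSpace E] : Type _ := {U : Set E // IsOpen U ∧ U.Nonempty}

/-- A strategy of player `β'`: it assigns to every sequence of `2 * n` non-empty open sets (all the
moves made so far, on both boards) the next move.  The first move on each board (`n = 0`, `n = 1`)
is arbitrary.  For `n ≥ 2` it has to lie in the last answer of `α'` on the same board, which is the
move number `2 * n - 3`, three moves back (`V₂ = m 4` lies in `V₁' = m 1`, `W₂ = m 6` lies in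
`W₁' = m 3`, and so on). -/
structure BetaStrategy (E : Type*) [TopologicalSpace E] where
  move : (n : ℕ) → (Fin (2 * n) → Move E) → Move E
  legal : ∀ (n : ℕ) (hn : 2 ≤ n) (h : Fin (2 * n) → Move E),
    (move n h : Set E) ⊆ (h ⟨2 * n - 3, by omega⟩ : Set E)

/-- A strategy of player `α'`: it assigns to every sequence of `2 * n + 1` non-empty open sets
a next move contained in the last one. -/
structure AlphaStrategy (E : Type*) [TopologicalSpace E] where
  move : (n : ℕ) → (Fin (2 * n + 1) → Move E) → Move E
  legal : ∀ (n : ℕ) (h : Fin (2 * n + 1) → Move E),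
    (move n h : Set E) ⊆ (h ⟨2 * n, by omega⟩ : Set E)

variable {E : Type*} [TopologicalSpace E]

/-- The play of the strategy `α` of player `α'` against the strategy `β` of player `β'`. -/
def play (α : AlphaStrategy E) (β : BetaStrategy E) (n : ℕ) : Move E :=
  if n % 2 = 0 then β.move (n / 2) (fun i : Fin (2 * (n / 2)) => play α β i)
  else α.move (n / 2) (fun i : Fin (2 * (n / 2) + 1) => play α β i)
termination_by n
decreasing_by all_goals omega

/-- `α'` wins the play `m` if the sets chosen on the `V`-board have a common point and so do
those chosen on the `W`-board; otherwise `β'` wins. -/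
def AlphaWins (m : ℕ → Move E) : Prop :=
  (⋂ k : ℕ, (m (4 * k) : Set E)).Nonempty ∧ (⋂ k : ℕ, (m (4 * k + 2) : Set E)).Nonempty

/-- Player `α'` has a winning strategy. -/
def AlphaFavorable (E : Type*) [TopologicalSpace E] : Prop :=
  ∃ α : AlphaStrategy E, ∀ β : BetaStrategy E, AlphaWins (play α β)

/-- Player `β'` has a winning strategy. -/
def BetaFavorable (E : Type*) [TopologicalSpace E] : Prop :=
  ∃ β : BetaStrategy E, ∀ α : AlphaStrategy E, ¬ AlphaWins (play α β)

/-- The tandem game on `E` is determined: one of the two players has a winning strategy. -/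
def Determined (E : Type*) [TopologicalSpace E] : Prop :=
  AlphaFavorable E ∨ BetaFavorable E

end TandemGame

/-- `τ`-Baire spaces: every strategy of `β'` in the tandem game is beaten by some strategy
of `α'`. -/
def IsTauBaire (E : Type*) [TopologicalSpace E] : Prop :=
  ∀ β : TandemGame.BetaStrategy E, ∃ α : TandemGame.AlphaStrategy E,
    TandemGame.AlphaWins (TandemGame.play α β)

/-! ### The two-sided completion -/

/-- The two-sided uniformity of a topological group: the coarsest uniformity that is finer than
both the left and the right uniformity.  It induces the given topology. -/
@[reducible] def twoSidedUniformSpace (G : Type*) [TopologicalSpace G] [Group G]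
    [IsTopologicalGroup G] : UniformSpace G :=
  (IsTopologicalGroup.leftUniformSpace G ⊓ IsTopologicalGroup.rightUniformSpace G).replaceTopology
    (inf_idem _).symm

/-- `G` coincides with its two-sided completion: the canonical map of `G` into its Hausdorff
completion with respect to the two-sided uniformity is an isomorphism of uniform spaces. -/
def CoincidesWithTwoSidedCompletion (G : Type*) [TopologicalSpace G] [Group G]
    [IsTopologicalGroup G] : Prop :=
  letI : UniformSpace G := twoSidedUniformSpace G
  ∃ e : G ≃ᵤ UniformSpace.Completion G, ∀ x : G, e x = (x : UniformSpace.Completion G)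

open Filter Set Topology Uniformity

namespace TandemGame

section Play

variable {E : Type*} [TopologicalSpace E] (α : AlphaStrategy E) (β : BetaStrategy E)

/-! Both parts follow from a dichotomy: is `G` complete for the two-sided uniformity?

If so, `G` is its own completion. This uniformity is countably generated, so `G` is completely
metrizable, and `α'` wins by answering with shrinking balls (`alphaFavorable_of_completeSpace`).

If not, some two-sided Cauchy filter `F` has no limit, and `β'` wins. Whenever `β'` moves, the new
set is small and is translated into the answer just given on the other board, by almost all of `F`
on the `V`-board and of `F⁻¹` on the `W`-board (`exists_isGoodReply`). Common points `x` of the `V`s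
and `y` of the `W`s would give `g * x → y` along `F`, so `F` would converge to `y * x⁻¹`. Since `β'`
then has a winning strategy, `G` is not τ-Baire. -/

theorem play_even (n : ℕ) :
    play α β (2 * n) = β.move n (fun i : Fin (2 * n) => play α β i) := by
  have key : ∀ k, k = n → β.move k (fun i : Fin (2 * k) => play α β i) =
      β.move n (fun i : Fin (2 * n) => play α β i) := by
    rintro _ rfl
    rfl
  rw [play, if_pos (by omega)]
  exact key _ (by omega)

theorem play_odd (n : ℕ) :
    play α β (2 * n + 1) = α.move n (fun i : Fin (2 * n + 1) => play α β i) := by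
  have key : ∀ k, k = n → α.move k (fun i : Fin (2 * k + 1) => play α β i) =
      α.move n (fun i : Fin (2 * n + 1) => play α β i) := by
    rintro _ rfl
    rfl
  rw [play, if_neg (by omega)]
  exact key _ (by omega)

theorem play_odd_subset (n : ℕ) :
    (play α β (2 * n + 1) : Set E) ⊆ play α β (2 * n) := by
  rw [play_odd]
  exact α.legal n _

theorem play_even_subset (n : ℕ) :
    (play α β (2 * (n + 2)) : Set E) ⊆ play α β (2 * n + 1) := by
  rw [play_even]
  exact β.legal (n + 2) (by omega) _

end Play

/-- The move consisting of the whole space. -/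
def univMove (E : Type*) [TopologicalSpace E] [Nonempty E] : Move E :=
  ⟨univ, isOpen_univ, univ_nonempty⟩

theorem not_isTauBaire_of_betaFavorable {E : Type*} [TopologicalSpace E] (h : BetaFavorable E) :
    ¬ IsTauBaire E := by
  obtain ⟨β, hβ⟩ := h
  intro hE
  obtain ⟨α, hα⟩ := hE β
  exact hβ α hα

/-! ### Complete metric spaces: a winning strategy of `α'`. -/

section Complete

variable {X : Type*} [MetricSpace X]

theorem exists_ball_closedBall_subset (U : Move X) {δ : ℝ} (hδ : 0 < δ) :
    ∃ x : X, ∃ ε : ℝ, 0 < ε ∧ ε ≤ δ ∧ Metric.closedBall x ε ⊆ U := by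
  obtain ⟨x, hx⟩ := U.2.2
  obtain ⟨ε, hε, h⟩ := Metric.nhds_basis_closedBall.mem_iff.1 (U.2.1.mem_nhds hx)
  exact ⟨x, min ε δ, lt_min hε hδ, min_le_right _ _,
    (Metric.closedBall_subset_closedBall (min_le_left _ _)).trans h⟩

/-- A decreasing sequence of closed balls of a complete metric space whose radii tend to `0` has a
common point. -/
theorem nonempty_iInter_closedBall [CompleteSpace X] {c : ℕ → X} {r : ℕ → ℝ}
    (hpos : ∀ k, 0 < r k) (hr : Tendsto r atTop (𝓝 0))
    (hsub : ∀ k, Metric.closedBall (c (k + 1)) (r (k + 1)) ⊆ Metric.closedBall (c k) (r k)) :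
    (⋂ k, Metric.closedBall (c k) (r k)).Nonempty := by
  have hanti : Antitone fun k => Metric.closedBall (c k) (r k) := antitone_nat_of_succ_le hsub
  refine Metric.nonempty_iInter_of_nonempty_biInter (fun _ => Metric.isClosed_closedBall)
    (fun _ => Metric.isBounded_closedBall) (fun N => ⟨c N, ?_⟩) ?_
  · simp only [mem_iInter]
    exact fun n hn => hanti hn (Metric.mem_closedBall_self (hpos N).le)
  · refine squeeze_zero (fun _ => Metric.diam_nonneg)
      (fun k => Metric.diam_closedBall (hpos k).le) ?_
    simpa using hr.const_mul 2

variable (X) in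
theorem alphaFavorable_of_completeSpace [CompleteSpace X] : AlphaFavorable X := by
  choose c r hpos hle hsub using
    fun (U : Move X) (n : ℕ) => exists_ball_closedBall_subset U (Nat.one_div_pos_of_nat (n := n))
  let α : AlphaStrategy X :=
    { move := fun n h => ⟨Metric.ball (c (h ⟨2 * n, by omega⟩) n) (r (h ⟨2 * n, by omega⟩) n),
        Metric.isOpen_ball, ⟨_, Metric.mem_ball_self (hpos _ _)⟩⟩
      legal := fun n h => Metric.ball_subset_closedBall.trans (hsub _ _) }
  refine ⟨α, fun β => ?_⟩
  set m := play α β with hm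
  have hodd : ∀ n, (m (2 * n + 1) : Set X) = Metric.ball (c (m (2 * n)) n) (r (m (2 * n)) n) := by
    intro n
    rw [hm, play_odd]
  -- The `V`-board is `s = 0`, the `W`-board `s = 1`.
  have hboard : ∀ s, (⋂ k : ℕ, (m (2 * (2 * k + s)) : Set X)).Nonempty := by
    intro s
    obtain ⟨x, hx⟩ := nonempty_iInter_closedBall
      (c := fun k => c (m (2 * (2 * k + s))) (2 * k + s))
      (r := fun k => r (m (2 * (2 * k + s))) (2 * k + s)) (fun _ => hpos _ _)
      (squeeze_zero (fun _ => (hpos _ _).le) (fun _ => hle _ _)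
        (tendsto_one_div_add_atTop_nhds_zero_nat.comp
          (tendsto_atTop_mono (fun k => by omega : ∀ k : ℕ, k ≤ 2 * k + s) tendsto_id)))
      (fun k => by
        refine (hsub _ _).trans (Subset.trans ?_ Metric.ball_subset_closedBall)
        rw [← hodd, show 2 * (k + 1) + s = 2 * k + s + 2 by ring]
        exact play_even_subset α β _)
    exact ⟨x, mem_iInter.2 fun k => hsub _ _ (mem_iInter.1 hx k)⟩
  have h0 := hboard 0
  have h1 := hboard 1
  simp only [mul_add, ← mul_assoc] at h0 h1
  exact ⟨h0, h1⟩

end Complete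

/-! ### Non-convergent Cauchy filters: a winning strategy of `β'`. -/

section Group

variable {G : Type*} [Group G]

/-- The filter by which the moves of `β'` are to be translated into the preceding answers of `α'`:
`F` on the `V`-board and `F⁻¹` on the `W`-board. -/
def boardFilter (F : Filter G) (n : ℕ) : Filter G :=
  if Even n then F else F.map (·⁻¹)

instance boardFilter_neBot (F : Filter G) [F.NeBot] (n : ℕ) : (boardFilter F n).NeBot := by
  unfold boardFilter
  split_ifs <;> infer_instance

/-- Turns the translation property of one reply into the hypothesis `hWV` needed for the next, on
the other board. -/
theorem map_inv_boardFilter (F : Filter G) (n : ℕ) :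
    (boardFilter F (n + 1)).map (·⁻¹) = boardFilter F n := by
  by_cases h : Even n
  · rw [boardFilter, boardFilter, if_pos h, if_neg (by simpa [Nat.even_add_one] using h),
      Filter.map_map]
    simp
  · simp [boardFilter, h, Nat.even_add_one]

variable [MetricSpace G]

/-- The requirements on the answer `U` of `β'` to the move `last`: it lies in `prev`, its diameter
is at most `1 / (n + 1)`, and the elements of `H` eventually translate it into `last`. -/
def IsGoodReply (H : Filter G) (n : ℕ) (prev last U : Set G) : Prop :=
  U ⊆ prev ∧ (∀ x ∈ U, ∀ y ∈ U, dist x y ≤ 1 / ((n : ℝ) + 1)) ∧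
    ∀ᶠ h in H, MapsTo (h * ·) U last

open Classical in
/-- A good reply if there is one, and the move `prev` otherwise. -/
noncomputable def reply (H : Filter G) (n : ℕ) (prev last : Move G) : Move G :=
  if h : ∃ U : Move G, IsGoodReply H n prev last U then h.choose else prev

theorem reply_subset (H : Filter G) (n : ℕ) (prev last : Move G) :
    (reply H n prev last : Set G) ⊆ prev := by
  unfold reply
  split_ifs with h
  · exact h.choose_spec.1
  · exact Subset.rfl

theorem isGoodReply_reply {H : Filter G} {n : ℕ} {prev last : Move G}
    (h : ∃ U : Move G, IsGoodReply H n prev last U) :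
    IsGoodReply H n (prev : Set G) last (reply H n prev last : Set G) := by
  rw [reply, dif_pos h]
  exact h.choose_spec

/-- The strategy of `β'` that gives good replies. -/
noncomputable def translationStrategy (F : Filter G) : BetaStrategy G where
  move n h := reply (boardFilter F n) n
    -- The first default serves both opening moves, the second only the very first.
    (if hn : 2 ≤ n then h ⟨2 * n - 3, by omega⟩ else univMove G)
    (if hn : 1 ≤ n then h ⟨2 * n - 1, by omega⟩ else univMove G)
  legal n hn h := by
    refine (reply_subset _ _ _ _).trans ?_
    rw [dif_pos hn]

theorem play_translationStrategy_two (F : Filter G) (α : AlphaStrategy G) :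
    play α (translationStrategy F) (2 * 1) =
      reply (boardFilter F 1) 1 (univMove G) (play α (translationStrategy F) 1) := by
  rw [play_even]
  simp [translationStrategy]

theorem play_translationStrategy_even (F : Filter G) (α : AlphaStrategy G) (n : ℕ) :
    play α (translationStrategy F) (2 * (n + 2)) =
      reply (boardFilter F (n + 2)) (n + 2) (play α (translationStrategy F) (2 * n + 1))
        (play α (translationStrategy F) (2 * n + 3)) := by
  rw [play_even]
  simp only [translationStrategy]
  rw [dif_pos (by omega), dif_pos (by omega)]
  rfl

variable [IsTopologicalGroup G]

/-- If the elements of `H⁻¹` eventually translate `W` into `V`, then every move inside `W` has a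
good reply inside `V`. -/
theorem exists_isGoodReply {H : Filter G} [H.NeBot]
    (hH : Tendsto (fun p : G × G => p.2 * p.1⁻¹) (H ×ˢ H) (𝓝 1)) (n : ℕ) {V W : Set G}
    (hV : IsOpen V) (hWV : ∀ᶠ h in H, MapsTo (h⁻¹ * ·) W V) (W' : Move G)
    (hW' : (W' : Set G) ⊆ W) :
    ∃ U : Move G, IsGoodReply H n V W' U := by
  obtain ⟨w, hw⟩ := W'.2.2
  have hmul : Tendsto (fun p : G × G => p.1 * p.2) (𝓝 1 ×ˢ 𝓝 w) (𝓝 w) := by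
    have := (continuous_mul (M := G)).tendsto (1, w)
    rwa [nhds_prod_eq, one_mul] at this
  obtain ⟨O, hO, P, hP, hOP⟩ := mem_prod_iff.1 (hmul (W'.2.1.mem_nhds hw))
  obtain ⟨P', hP'P, hP'open, hwP'⟩ := mem_nhds_iff.1 hP
  have hcauchy : ∀ᶠ a in H, ∀ᶠ h in H, h * a⁻¹ ∈ O := Eventually.curry (hH hO)
  -- One fixed `a` carries a small neighbourhood of `a⁻¹ * w` close to `w`; any later `h` differs
  -- from `a` by the factor `h * a⁻¹`, close to `1`.
  obtain ⟨a, ha, haV⟩ := (hcauchy.and hWV).exists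
  have hδ : (0 : ℝ) < 1 / ((n : ℝ) + 1) / 2 := half_pos Nat.one_div_pos_of_nat
  refine ⟨⟨(V ∩ (a * ·) ⁻¹' P') ∩ Metric.ball (a⁻¹ * w) (1 / ((n : ℝ) + 1) / 2),
    (hV.inter (hP'open.preimage (continuous_const_mul a))).inter Metric.isOpen_ball,
    ⟨a⁻¹ * w, ⟨haV (hW' hw), by simpa using hwP'⟩, Metric.mem_ball_self hδ⟩⟩,
    fun x hx => hx.1.1, fun x hx y hy => ?_, ?_⟩
  · have := dist_triangle_right x y (a⁻¹ * w)
    have h1 := Metric.mem_ball.1 hx.2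
    have h2 := Metric.mem_ball.1 hy.2
    linarith
  · filter_upwards [ha] with h hh x hx
    have : h * a⁻¹ * (a * x) ∈ (W' : Set G) := hOP (mk_mem_prod hh (hP'P hx.1.2))
    simpa [mul_assoc] using this

/-- Inversion exchanges the left and right uniformities, so the two boards together need `F` to be
Cauchy for both. -/
theorem tendsto_boardFilter {F : Filter G}
    (hr : Tendsto (fun p : G × G => p.2 * p.1⁻¹) (F ×ˢ F) (𝓝 1))
    (hl : Tendsto (fun p : G × G => p.1⁻¹ * p.2) (F ×ˢ F) (𝓝 1)) (n : ℕ) :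
    Tendsto (fun p : G × G => p.2 * p.1⁻¹) (boardFilter F n ×ˢ boardFilter F n) (𝓝 1) := by
  unfold boardFilter
  split_ifs
  · exact hr
  · rw [prod_map_map_eq, tendsto_map'_iff]
    simpa [Function.comp_def] using hl.inv

/-- Induction along the play: each good reply makes the next one possible, so from the second move
of `β'` on the default in `reply` is never used. -/
theorem isGoodReply_translationStrategy {F : Filter G} [F.NeBot]
    (hr : Tendsto (fun p : G × G => p.2 * p.1⁻¹) (F ×ˢ F) (𝓝 1))
    (hl : Tendsto (fun p : G × G => p.1⁻¹ * p.2) (F ×ˢ F) (𝓝 1)) (α : AlphaStrategy G) (n : ℕ) :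
    ∃ prev : Set G, IsGoodReply (boardFilter F (n + 1)) (n + 1) prev
      (play α (translationStrategy F) (2 * n + 1))
      (play α (translationStrategy F) (2 * (n + 1))) := by
  induction n with
  | zero =>
    refine ⟨univ, ?_⟩
    rw [zero_add, play_translationStrategy_two]
    exact isGoodReply_reply (exists_isGoodReply (tendsto_boardFilter hr hl 1) 1 isOpen_univ
      (W := univ) (Eventually.of_forall fun _ => mapsTo_univ _ _) _ (subset_univ _))
  | succ n ih =>
    obtain ⟨prev, -, -, ih⟩ := ih
    refine ⟨play α (translationStrategy F) (2 * n + 1), ?_⟩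
    rw [play_translationStrategy_even]
    refine isGoodReply_reply (exists_isGoodReply (tendsto_boardFilter hr hl (n + 2)) (n + 2)
      (play α (translationStrategy F) (2 * n + 1)).2.1 ?_ _ (play_odd_subset α _ (n + 1)))
    rwa [← map_inv_boardFilter F (n + 1), eventually_map] at ih

/-- A filter that is Cauchy for the two-sided uniformity and does not converge yields a winning
strategy of `β'`. -/
theorem betaFavorable_of_not_converging {F : Filter G} [F.NeBot]
    (hr : Tendsto (fun p : G × G => p.2 * p.1⁻¹) (F ×ˢ F) (𝓝 1))
    (hl : Tendsto (fun p : G × G => p.1⁻¹ * p.2) (F ×ˢ F) (𝓝 1)) (hF : ∀ x, ¬ F ≤ 𝓝 x) :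
    BetaFavorable G := by
  refine ⟨translationStrategy F, ?_⟩
  rintro α ⟨⟨x, hx⟩, ⟨y, hy⟩⟩
  rw [mem_iInter] at hx hy
  have hxy : Tendsto (· * x) F (𝓝 y) := by
    refine Metric.tendsto_nhds.2 fun ε hε => ?_
    obtain ⟨k, hk⟩ := exists_nat_one_div_lt hε
    -- This reply is the small set `W_{k+1}`; the next one is `V_{k+2}`, which `F` eventually
    -- translates into `W'_{k+1}`.
    obtain ⟨_, -, hsmall, -⟩ := isGoodReply_translationStrategy hr hl α (2 * k)
    obtain ⟨_, -, -, hmaps⟩ := isGoodReply_translationStrategy hr hl α (2 * k + 1)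
    have heven : Even (2 * k + 1 + 1) := by simp [Nat.even_add_one]
    rw [boardFilter, if_pos heven] at hmaps
    filter_upwards [hmaps] with g hg
    have hgx := play_odd_subset α (translationStrategy F) (2 * k + 1)
      (hg (x := x) (by convert hx (k + 1) using 3; ring))
    have hyk : y ∈ (play α (translationStrategy F) (2 * (2 * k + 1)) : Set G) := by
      convert hy k using 3; ring
    refine (hsmall _ hgx _ hyk).trans_lt (lt_of_le_of_lt ?_ hk)
    refine one_div_le_one_div_of_le (by positivity) ?_
    push_cast
    linarith [(Nat.cast_nonneg k : (0 : ℝ) ≤ k)]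
  refine hF (y * x⁻¹) ?_
  have := hxy.mul_const x⁻¹
  simpa [Tendsto] using this

end Group

end TandemGame

/-! ### Completeness for the two-sided uniformity. -/

section TwoSided

variable (G : Type*) [TopologicalSpace G] [Group G] [IsTopologicalGroup G]

theorem uniformity_twoSidedUniformSpace :
    𝓤[twoSidedUniformSpace G] =
      comap (fun p : G × G => p.1⁻¹ * p.2) (𝓝 1) ⊓ comap (fun p : G × G => p.2 * p.1⁻¹) (𝓝 1) :=
  rfl

theorem isCompletelyMetrizableSpace_of_completeSpace_twoSided [MetrizableSpace G]
    (h : @CompleteSpace G (twoSidedUniformSpace G)) : IsCompletelyMetrizableSpace G := by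
  let : UniformSpace G := twoSidedUniformSpace G
  have : (𝓤 G).IsCountablyGenerated := by
    rw [uniformity_twoSidedUniformSpace]
    infer_instance
  infer_instance

theorem coincidesWithTwoSidedCompletion_of_completeSpace [T0Space G]
    (h : @CompleteSpace G (twoSidedUniformSpace G)) : CoincidesWithTwoSidedCompletion G := by
  let : UniformSpace G := twoSidedUniformSpace G
  -- A complete T0 space is a completion of itself, and completions are unique.
  exact ⟨AbstractCompletion.ofComplete.compareEquiv UniformSpace.Completion.cPkg,
    AbstractCompletion.compare_coe _ _⟩

theorem betaFavorable_of_not_completeSpace_twoSided [MetrizableSpace G]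
    (h : ¬ @CompleteSpace G (twoSidedUniformSpace G)) : TandemGame.BetaFavorable G := by
  let : MetricSpace G := metrizableSpaceMetric G
  by_contra hβ
  refine h (@CompleteSpace.mk G (twoSidedUniformSpace G) fun {F} hF => ?_)
  by_contra! hlim
  obtain ⟨hne, hle⟩ := hF
  rw [uniformity_twoSidedUniformSpace, le_inf_iff, ← tendsto_iff_comap, ← tendsto_iff_comap] at hle
  exact hβ (TandemGame.betaFavorable_of_not_converging hle.2 hle.1 hlim)

end TwoSided

theorem TandemGame.alphaFavorable_of_isCompletelyMetrizableSpace (X : Type*) [TopologicalSpace X]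
    [IsCompletelyMetrizableSpace X] : TandemGame.AlphaFavorable X := by
  let := upgradeIsCompletelyMetrizable X
  exact TandemGame.alphaFavorable_of_completeSpace X

theorem proposition7p2 (G : Type*) [TopologicalSpace G] [Group G] [IsTopologicalGroup G]
    [MetrizableSpace G] :
    (IsTauBaire G → IsCompletelyMetrizableSpace G ∧ CoincidesWithTwoSidedCompletion G) ∧
      TandemGame.Determined G := by
  by_cases h : @CompleteSpace G (twoSidedUniformSpace G)
  · have := isCompletelyMetrizableSpace_of_completeSpace_twoSided G h
    exact ⟨fun _ => ⟨this, coincidesWithTwoSidedCompletion_of_completeSpace G h⟩,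
      Or.inl (TandemGame.alphaFavorable_of_isCompletelyMetrizableSpace G)⟩
  · have hβ := betaFavorable_of_not_completeSpace_twoSided G h
    exact ⟨fun hG => absurd hG (TandemGame.not_isTauBaire_of_betaFavorable hβ), Or.inr hβ⟩
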